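/- A pair of morphisms $r_1,r_2\colon R\to X$ in a category is a \emph{reflexive relation} on $X$ if it is jointly monic and there is $e\colon X\to R$ with $r_1e=1_X=r_2e$. In a pointed category (a category with a zero object), it is \emph{left punctual} if there is $s\colon X\to R$ with $r_1s=1_X$ and $r_2s=0$, and \emph{right punctual} if there is $s\colon X\to R$ with $r_1s=0$ and $r_2s=1_X$. A \emph{subtractive category} is a pointed category with finite limits in which every left punctual reflexive relation is right punctual. A \emph{regular category} is a category with finite limits and coequalizers of kernel pairs in which regular epimorphisms are stable under pullback. For a small finitely complete category $\mathbb{C}$, its \emph{pro-completion} is $\mathrm{Lex}(\mathbb{C},\mathbf{Set})^{\mathrm{op}}$, the dual of the category of finite limit preserving functors $\mathbb{C}\to\mathbf{Set}$. \textbf{Theorem.} (1) If $\mathbb{C}$ is a small regular subtractive category, then its pro-completion $\mathrm{Lex}(\mathbb{C},\mathbf{Set})^{\mathrm{op}}$ is again a regular subtractive category. (2) Under the axiom of universes, every regular subtractive category $\mathbb{C}$ (not necessarily small) admits an embedding into a regular subtractive category $\mathbb{D}$ with binary coproducts; that is, there are such a $\mathbb{D}$, which may live in the next universe, and a functor $\mathbb{C}\to\mathbb{D}$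 that is fully faithful, injective on objects, and preserves finite limits and all colimits that exist in $\mathbb{C}$. (This answers positively an open question of Bourn and Janelidze.) -/

import Mathlib

open CategoryTheory CategoryTheory.Limits

universe t u v w₁ w₂

/-- A morphism is a zero morphism if it factors through a zero object. -/
def IsZeroMorphism {C : Type u} [Category.{v} C] {X Y : C} (f : X ⟶ Y) : Prop :=
  ∃ (Z : C) (_ : IsZero Z) (a : X ⟶ Z) (b : Z ⟶ Y), a ≫ b = f

/-- The relation `(r₁, r₂)` on `X` is left punctual: `⟨1, 0⟩` factors through it. -/
def IsLeftPunctual {C : Type u} [Category.{v} C] {R X : C} (r₁ r₂ : R ⟶ X) : Prop :=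
  ∃ s : X ⟶ R, s ≫ r₁ = 𝟙 X ∧ IsZeroMorphism (s ≫ r₂)

/-- The relation `(r₁, r₂)` on `X` is right punctual: `⟨0, 1⟩` factors through it. -/
def IsRightPunctual {C : Type u} [Category.{v} C] {R X : C} (r₁ r₂ : R ⟶ X) : Prop :=
  ∃ s : X ⟶ R, IsZeroMorphism (s ≫ r₁) ∧ s ≫ r₂ = 𝟙 X

/-- A subtractive category: a pointed category with finite limits in which every left punctual
reflexive relation is right punctual. (Here `ReflexiveRelation r₁ r₂` says that the pair
`r₁ r₂ : R ⟶ X` is jointly monic and that the diagonal of `X` factors through it.) -/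
class SubtractiveCategory (C : Type u) [Category.{v} C] : Prop
    extends HasFiniteLimits C, HasZeroObject C where
  isRightPunctual : ∀ {R X : C} (r₁ r₂ : R ⟶ X), ReflexiveRelation r₁ r₂ →
    IsLeftPunctual r₁ r₂ → IsRightPunctual r₁ r₂

/-- The pro-completion of a small finitely complete category `C`: the dual of the category of
finite limit preserving functors from `C` to sets. -/
abbrev ProCompletion (C : Type t) [SmallCategory C] : Type (t + 1) :=
  (C ⥤ₗ Type t)ᵒᵖ

/-! ### Elements of finite limit preserving functors. -/

section Elements

variable {C : Type u} [Category.{v} C] (X : C ⥤ Type w₁) [PreservesFiniteLimits X]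

/-! Everything is done dually, with elements of finite limit preserving functors. A cospan of
pro-objects is a cofiltered limit of cospans in `C`, and its pullback is the limit of their
pullbacks. Dually, `lexPushout` is a filtered colimit of corepresentables, so any equation in a
pushout is witnessed by one cospan in `C`.

Regularity rests on `LexFunctor.isRegularMono_iff`: a morphism is a regular mono exactly when
elements lift along it over each mono of `C`. Image factorisations in `C` show that this condition
passes to pushouts.

For subtractivity, let `ρ₁`, `ρ₂` be dual to a left punctual reflexive relation, and push `ρ₁` out
along the map to zero (in the pro-completion: take the kernel of the first projection). Then `ρ₂`
followed by the coprojection is epi by joint epicness. It is a regular mono because right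
punctuality holds locally in `C`, up to a regular epi (`exists_local_right_punctual`). Being
invertible, it yields the required section.

For an arbitrary `C`, pass to an equivalent small category in a larger universe and embed it by
coyoneda. -/

theorem exists_of_isPullback_map {a b c p : C} {f : a ⟶ c} {g : b ⟶ c} {fst : p ⟶ a}
    {snd : p ⟶ b} (h : IsPullback fst snd f g) (x : X.obj a) (y : X.obj b)
    (hxy : X.map f x = X.map g y) : ∃ z : X.obj p, X.map fst z = x ∧ X.map snd z = y :=
  Types.exists_of_isPullback (h.map X) x y hxy

theorem ext_of_isPullback_map {a b c p : C} {f : a ⟶ c} {g : b ⟶ c} {fst : p ⟶ a}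
    {snd : p ⟶ b} (h : IsPullback fst snd f g) {x y : X.obj p}
    (h₁ : X.map fst x = X.map fst y) (h₂ : X.map snd x = X.map snd y) : x = y :=
  Types.ext_of_isPullback (h.map X) h₁ h₂

theorem map_injective_of_mono {a b : C} (m : a ⟶ b) [Mono m] {x y : X.obj a}
    (h : X.map m x = X.map m y) : x = y :=
  (mono_iff_injective (X.map m)).1 inferInstance h

theorem nonempty_unique_of_isTerminal {a : C} (ha : IsTerminal a) :
    Nonempty (Unique (X.obj a)) :=
  ⟨Types.isTerminalEquivUnique _ (ha.isTerminalObj X)⟩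

theorem exists_equalizer_map [HasEqualizers C] {a b : C} (f g : a ⟶ b) (x : X.obj a)
    (h : X.map f x = X.map g x) : ∃ z : X.obj (equalizer f g), X.map (equalizer.ι f g) z = x := by
  have := (Types.type_equalizer_iff_unique (X.map (equalizer.ι f g)) (g := X.map f)
    (h := X.map g) (by rw [← X.map_comp, ← X.map_comp, equalizer.condition])).1
    ⟨isLimitForkMapOfIsLimit X _ (equalizerIsEqualizer f g)⟩
  exact (this x h).exists

theorem exists_prod_map [HasFiniteLimits C] {a b : C} (x : X.obj a) (y : X.obj b) :
    ∃ z : X.obj (a ⨯ b), X.map prod.fst z = x ∧ X.map prod.snd z = y := by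
  obtain ⟨h⟩ := nonempty_unique_of_isTerminal X (terminalIsTerminal (C := C))
  exact exists_of_isPullback_map X
    (IsPullback.of_isLimit_binaryFan_of_isTerminal (prodIsProd a b) terminalIsTerminal) x y
    (Subsingleton.elim _ _)

theorem ext_prod_map [HasFiniteLimits C] {a b : C} {x y : X.obj (a ⨯ b)}
    (h₁ : X.map prod.fst x = X.map prod.fst y) (h₂ : X.map prod.snd x = X.map prod.snd y) :
    x = y :=
  ext_of_isPullback_map X
    (IsPullback.of_isLimit_binaryFan_of_isTerminal (prodIsProd a b) terminalIsTerminal) h₁ h₂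

end Elements

/-! ### Pushouts of finite limit preserving functors as filtered colimits. -/

section

variable {C : Type t} [SmallCategory C] {F G H : C ⥤ Type t}

/-- Cospans `c ⟶ d ⟵ k` in `C` with compatible elements of `G`, `F` and `H` over them. -/
structure CospanElements (α : F ⟶ G) (β : F ⟶ H) where
  c : C
  d : C
  k : C
  f : c ⟶ d
  g : k ⟶ d
  x : F.obj d
  y : G.obj c
  z : H.obj k
  map_y : G.map f y = α.app d x
  map_z : H.map g z = β.app d x

namespace CospanElements

variable {α : F ⟶ G} {β : F ⟶ H}

/-- Morphisms of cospans that respect the chosen elements. -/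
@[ext]
structure Hom (e e' : CospanElements α β) where
  c : e.c ⟶ e'.c
  d : e.d ⟶ e'.d
  k : e.k ⟶ e'.k
  f : c ≫ e'.f = e.f ≫ d
  g : k ≫ e'.g = e.g ≫ d
  x : F.map d e.x = e'.x
  y : G.map c e.y = e'.y
  z : H.map k e.z = e'.z

instance : SmallCategory (CospanElements α β) where
  Hom := Hom
  id e := { c := 𝟙 _, d := 𝟙 _, k := 𝟙 _, f := by simp, g := by simp, x := by simp,
            y := by simp, z := by simp }
  comp φ ψ :=
    { c := φ.c ≫ ψ.c, d := φ.d ≫ ψ.d, k := φ.k ≫ ψ.k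
      f := by rw [Category.assoc, ψ.f, ← Category.assoc, φ.f, Category.assoc]
      g := by rw [Category.assoc, ψ.g, ← Category.assoc, φ.g, Category.assoc]
      x := by simp [φ.x, ψ.x]
      y := by simp [φ.y, ψ.y]
      z := by simp [φ.z, ψ.z] }

variable [HasFiniteLimits C]

/-- The map on pullbacks induced by a morphism of cospans. -/
noncomputable def pullbackMap {e e' : CospanElements α β} (φ : e ⟶ e') :
    pullback e.f e.g ⟶ pullback e'.f e'.g :=
  pullback.lift (pullback.fst _ _ ≫ φ.c) (pullback.snd _ _ ≫ φ.k) (by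
    rw [Category.assoc, Category.assoc, φ.f, φ.g, pullback.condition_assoc])

theorem pullbackMap_fst {e e' : CospanElements α β} (φ : e ⟶ e') :
    pullbackMap φ ≫ pullback.fst _ _ = pullback.fst _ _ ≫ φ.c :=
  pullback.lift_fst _ _ _

theorem pullbackMap_snd {e e' : CospanElements α β} (φ : e ⟶ e') :
    pullbackMap φ ≫ pullback.snd _ _ = pullback.snd _ _ ≫ φ.k :=
  pullback.lift_snd _ _ _

variable (α β) in
/-- The functor that takes the pullback of a cospan. -/
noncomputable def pullbackFunctor : CospanElements α β ⥤ C where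
  obj e := pullback e.f e.g
  map φ := pullbackMap φ
  map_id e := pullback.hom_ext
    ((pullbackMap_fst _).trans ((Category.comp_id _).trans (Category.id_comp _).symm))
    ((pullbackMap_snd _).trans ((Category.comp_id _).trans (Category.id_comp _).symm))
  map_comp φ ψ := pullback.hom_ext
    (by
      rw [Category.assoc, pullbackMap_fst, pullbackMap_fst, ← Category.assoc, pullbackMap_fst]
      exact (Category.assoc _ _ _).symm)
    (by
      rw [Category.assoc, pullbackMap_snd, pullbackMap_snd, ← Category.assoc, pullbackMap_snd]
      exact (Category.assoc _ _ _).symm)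

variable [PreservesFiniteLimits F] [PreservesFiniteLimits G] [PreservesFiniteLimits H]

/-- Terminal objects, products and equalizers of cospans are formed in `C`; the chosen elements lift
to them because `F`, `G` and `H` preserve finite limits. -/
theorem isCofiltered : IsCofiltered (CospanElements α β) where
  nonempty := by
    obtain ⟨hF⟩ := nonempty_unique_of_isTerminal F (terminalIsTerminal (C := C))
    obtain ⟨hG⟩ := nonempty_unique_of_isTerminal G (terminalIsTerminal (C := C))
    obtain ⟨hH⟩ := nonempty_unique_of_isTerminal H (terminalIsTerminal (C := C))
    exact ⟨⟨⊤_ C, ⊤_ C, ⊤_ C, 𝟙 _, 𝟙 _, default, default, default, Subsingleton.elim _ _,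
      Subsingleton.elim _ _⟩⟩
  cone_objs e e' := by
    obtain ⟨x, hx, hx'⟩ := exists_prod_map F e.x e'.x
    obtain ⟨y, hy, hy'⟩ := exists_prod_map G e.y e'.y
    obtain ⟨z, hz, hz'⟩ := exists_prod_map H e.z e'.z
    refine ⟨⟨_, _, _, prod.map e.f e'.f, prod.map e.g e'.g, x, y, z, ?_, ?_⟩,
      ⟨prod.fst, prod.fst, prod.fst, by simp, by simp, hx, hy, hz⟩,
      ⟨prod.snd, prod.snd, prod.snd, by simp, by simp, hx', hy', hz'⟩, trivial⟩
    · apply ext_prod_map G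
      · rw [← NatTrans.naturality_apply, hx, ← e.map_y, ← hy]
        simp only [← Functor.map_comp_apply, prod.map_fst]
      · rw [← NatTrans.naturality_apply, hx', ← e'.map_y, ← hy']
        simp only [← Functor.map_comp_apply, prod.map_snd]
    · apply ext_prod_map H
      · rw [← NatTrans.naturality_apply, hx, ← e.map_z, ← hz]
        simp only [← Functor.map_comp_apply, prod.map_fst]
      · rw [← NatTrans.naturality_apply, hx', ← e'.map_z, ← hz']
        simp only [← Functor.map_comp_apply, prod.map_snd]
  cone_maps e e' φ ψ := by
    obtain ⟨x, hx⟩ := exists_equalizer_map F φ.d ψ.d e.x (φ.x.trans ψ.x.symm)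
    obtain ⟨y, hy⟩ := exists_equalizer_map G φ.c ψ.c e.y (φ.y.trans ψ.y.symm)
    obtain ⟨z, hz⟩ := exists_equalizer_map H φ.k ψ.k e.z (φ.z.trans ψ.z.symm)
    refine ⟨⟨_, _, _, equalizer.lift (equalizer.ι φ.c ψ.c ≫ e.f) ?_,
      equalizer.lift (equalizer.ι φ.k ψ.k ≫ e.g) ?_, x, y, z, ?_, ?_⟩,
      ⟨equalizer.ι _ _, equalizer.ι _ _, equalizer.ι _ _,
        (equalizer.lift_ι _ _).symm, (equalizer.lift_ι _ _).symm, hx, hy, hz⟩, ?_⟩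
    · rw [Category.assoc, Category.assoc, ← φ.f, ← ψ.f, equalizer.condition_assoc]
    · rw [Category.assoc, Category.assoc, ← φ.g, ← ψ.g, equalizer.condition_assoc]
    · apply map_injective_of_mono G (equalizer.ι _ _)
      rw [← NatTrans.naturality_apply, hx, ← e.map_y, ← hy]
      simp only [← Functor.map_comp_apply, equalizer.lift_ι]
    · apply map_injective_of_mono H (equalizer.ι _ _)
      rw [← NatTrans.naturality_apply, hx, ← e.map_z, ← hz]
      simp only [← Functor.map_comp_apply, equalizer.lift_ι]
    · apply Hom.ext
      · exact equalizer.condition _ _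
      · exact equalizer.condition _ _
      · exact equalizer.condition _ _

instance : IsCofiltered (CospanElements α β) := isCofiltered

end CospanElements

variable [HasFiniteLimits C] (α : F ⟶ G) (β : F ⟶ H)

/-- The pushout of `α` and `β` in the category of finite limit preserving functors. -/
noncomputable def lexPushout : C ⥤ Type t :=
  ((CospanElements.pullbackFunctor α β).op ⋙ coyoneda).flip ⋙ colim

/-- Filtered colimits of sets commute with finite limits, and each corepresentable preserves them.
-/
instance [PreservesFiniteLimits F] [PreservesFiniteLimits G] [PreservesFiniteLimits H] :
    PreservesFiniteLimits (lexPushout α β) := by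
  have : PreservesFiniteLimits
      ((CospanElements.pullbackFunctor α β).op ⋙ coyoneda (C := C)).flip := by
    refine ⟨fun J _ _ => preservesLimitsOfShape_of_evaluation _ _ fun e => ?_⟩
    exact inferInstanceAs (PreservesLimitsOfShape J (coyoneda.obj _))
  exact comp_preservesFiniteLimits _ _

end

section

variable {C : Type t} [SmallCategory C] [HasFiniteLimits C] {F G H : C ⥤ Type t}

namespace lexPushout

variable {α : F ⟶ G} {β : F ⟶ H}

/-- The element of the pushout represented by a morphism out of the pullback of a cospan. -/
noncomputable def mk (e : CospanElements α β) {a : C} (h : pullback e.f e.g ⟶ a) :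
    (lexPushout α β).obj a :=
  colimit.ι (((CospanElements.pullbackFunctor α β).op ⋙ coyoneda).flip.obj a) (.op e) h

theorem exists_mk {a : C} (w : (lexPushout α β).obj a) :
    ∃ (e : CospanElements α β) (h : pullback e.f e.g ⟶ a), mk e h = w := by
  obtain ⟨e, h, rfl⟩ := Types.jointly_surjective'
    (F := ((CospanElements.pullbackFunctor α β).op ⋙ coyoneda).flip.obj a) w
  exact ⟨e.unop, h, rfl⟩

theorem map_mk (e : CospanElements α β) {a b : C} (h : pullback e.f e.g ⟶ a) (m : a ⟶ b) :
    (lexPushout α β).map m (mk e h) = mk e (h ≫ m) :=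
  ConcreteCategory.congr_hom (ι_colimMap
    (((CospanElements.pullbackFunctor α β).op ⋙ coyoneda).flip.map m) (.op e)) h

theorem mk_map {e e' : CospanElements α β} (φ : e ⟶ e') {a : C} (h : pullback e'.f e'.g ⟶ a) :
    mk e (CospanElements.pullbackMap φ ≫ h) = mk e' h :=
  ConcreteCategory.congr_hom (colimit.w
    (((CospanElements.pullbackFunctor α β).op ⋙ coyoneda).flip.obj a) φ.op) h

theorem exists_desc_element {T : C ⥤ Type t} [PreservesFiniteLimits T]
    (p : G ⟶ T) (q : H ⟶ T) (hpq : α ≫ p = β ≫ q)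
    (e : CospanElements α β) : ∃ τ : T.obj (pullback e.f e.g),
      T.map (pullback.fst _ _) τ = p.app _ e.y ∧ T.map (pullback.snd _ _) τ = q.app _ e.z := by
  apply exists_of_isPullback_map T (IsPullback.of_hasPullback e.f e.g)
  rw [← NatTrans.naturality_apply, ← NatTrans.naturality_apply, e.map_y, e.map_z]
  exact ConcreteCategory.congr_hom (congr_app hpq e.d) e.x

variable [PreservesFiniteLimits F] [PreservesFiniteLimits G] [PreservesFiniteLimits H]

theorem exists_of_mk_eq {e e' : CospanElements α β} {a : C} {h : pullback e.f e.g ⟶ a}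
    {h' : pullback e'.f e'.g ⟶ a} (heq : mk e h = mk e' h') :
    ∃ (e'' : CospanElements α β) (φ : e'' ⟶ e) (φ' : e'' ⟶ e'),
      CospanElements.pullbackMap φ ≫ h =
        CospanElements.pullbackMap φ' ≫ h' := by
  obtain ⟨e'', φ, φ', w⟩ := (Types.FilteredColimit.colimit_eq_iff
    (((CospanElements.pullbackFunctor α β).op ⋙ coyoneda).flip.obj a)).1 heq
  exact ⟨e''.unop, φ.unop, φ'.unop, w⟩

/-- The cospan with trivial second leg. -/
noncomputable def cospanLeft (α : F ⟶ G) (β : F ⟶ H) {a : C} (y : G.obj a) :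
    CospanElements α β :=
  have _hF := (nonempty_unique_of_isTerminal F (terminalIsTerminal (C := C))).some
  have _hG := (nonempty_unique_of_isTerminal G (terminalIsTerminal (C := C))).some
  have _hH := (nonempty_unique_of_isTerminal H (terminalIsTerminal (C := C))).some
  ⟨a, ⊤_ C, ⊤_ C, terminal.from _, 𝟙 _, default, y, default, Subsingleton.elim _ _,
    Subsingleton.elim _ _⟩

/-- The cospan with trivial first leg. -/
noncomputable def cospanRight (α : F ⟶ G) (β : F ⟶ H) {a : C} (z : H.obj a) :
    CospanElements α β :=
  have _hF := (nonempty_unique_of_isTerminal F (terminalIsTerminal (C := C))).some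
  have _hG := (nonempty_unique_of_isTerminal G (terminalIsTerminal (C := C))).some
  have _hH := (nonempty_unique_of_isTerminal H (terminalIsTerminal (C := C))).some
  ⟨⊤_ C, ⊤_ C, a, 𝟙 _, terminal.from _, default, default, z, Subsingleton.elim _ _,
    Subsingleton.elim _ _⟩

/-- Morphisms into a cospan with trivial second leg. -/
noncomputable def homCospanLeft (e : CospanElements α β) {a : C} (u : e.c ⟶ a) {y : G.obj a}
    (hy : G.map u e.y = y) : e ⟶ cospanLeft α β y :=
  have hF := (nonempty_unique_of_isTerminal F (terminalIsTerminal (C := C))).some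
  have hH := (nonempty_unique_of_isTerminal H (terminalIsTerminal (C := C))).some
  { c := u, d := terminal.from _, k := terminal.from _,
    f := terminal.hom_ext _ _, g := terminal.hom_ext _ _
    x := hF.instSubsingleton.elim _ _, y := hy, z := hH.instSubsingleton.elim _ _ }

/-- Morphisms into a cospan with trivial first leg. -/
noncomputable def homCospanRight (e : CospanElements α β) {a : C} (u : e.k ⟶ a) {z : H.obj a}
    (hz : H.map u e.z = z) : e ⟶ cospanRight α β z :=
  have hF := (nonempty_unique_of_isTerminal F (terminalIsTerminal (C := C))).some
  have hG := (nonempty_unique_of_isTerminal G (terminalIsTerminal (C := C))).some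
  { c := terminal.from _, d := terminal.from _, k := u,
    f := terminal.hom_ext _ _, g := terminal.hom_ext _ _
    x := hF.instSubsingleton.elim _ _, y := hG.instSubsingleton.elim _ _, z := hz }

theorem mk_fst (e : CospanElements α β) {a : C} (u : e.c ⟶ a) {y : G.obj a}
    (hy : G.map u e.y = y) :
    mk e (pullback.fst _ _ ≫ u) =
      mk (cospanLeft α β y) (pullback.fst (cospanLeft α β y).f (cospanLeft α β y).g) := by
  rw [← mk_map (homCospanLeft e u hy)]
  rw [CospanElements.pullbackMap_fst]
  rfl

theorem mk_snd (e : CospanElements α β) {a : C} (u : e.k ⟶ a) {z : H.obj a}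
    (hz : H.map u e.z = z) :
    mk e (pullback.snd _ _ ≫ u) =
      mk (cospanRight α β z) (pullback.snd (cospanRight α β z).f (cospanRight α β z).g) := by
  rw [← mk_map (homCospanRight e u hz)]
  rw [CospanElements.pullbackMap_snd]
  rfl

variable (α β)

/-- The first coprojection. -/
noncomputable def inl : G ⟶ lexPushout α β where
  app a := ↾ fun y => mk (cospanLeft α β y) (pullback.fst _ _)
  naturality a b m := by
    ext y
    exact (mk_fst (cospanLeft α β y) m rfl).symm.trans (map_mk _ _ _).symm

/-- The second coprojection. -/
noncomputable def inr : H ⟶ lexPushout α β where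
  app a := ↾ fun z => mk (cospanRight α β z) (pullback.snd _ _)
  naturality a b m := by
    ext z
    exact (mk_snd (cospanRight α β z) m rfl).symm.trans (map_mk _ _ _).symm

variable {α β}

theorem inl_map (e : CospanElements α β) {a : C} (u : e.c ⟶ a) :
    (inl α β).app a (G.map u e.y) = mk e (pullback.fst _ _ ≫ u) :=
  (mk_fst e u rfl).symm

theorem inr_map (e : CospanElements α β) {a : C} (u : e.k ⟶ a) :
    (inr α β).app a (H.map u e.z) = mk e (pullback.snd _ _ ≫ u) :=
  (mk_snd e u rfl).symm

theorem condition : α ≫ inl α β = β ≫ inr α β := by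
  ext a x
  let e : CospanElements α β :=
    ⟨a, a, a, 𝟙 a, 𝟙 a, x, α.app a x, β.app a x, by simp, by simp⟩
  have h₁ := inl_map e (𝟙 a)
  have h₂ := inr_map e (𝟙 a)
  have h : pullback.fst e.f e.g ≫ 𝟙 a = pullback.snd e.f e.g ≫ 𝟙 a := pullback.condition
  rw [h, ← h₂] at h₁
  simpa [e] using h₁

/-- An equation between a value of the first coprojection and the image of an element under a
map is witnessed by a cospan. -/
theorem exists_of_map_eq_inl {a b : C} (m : a ⟶ b) (w : (lexPushout α β).obj a) (y : G.obj b)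
    (hw : (lexPushout α β).map m w = (inl α β).app b y) :
    ∃ (e : CospanElements α β) (u : e.c ⟶ b) (h : pullback e.f e.g ⟶ a),
      G.map u e.y = y ∧ h ≫ m = pullback.fst e.f e.g ≫ u := by
  obtain ⟨e, h, rfl⟩ := exists_mk w
  rw [map_mk] at hw
  obtain ⟨e', φ, ψ, h'⟩ := exists_of_mk_eq hw
  refine ⟨e', ψ.c, CospanElements.pullbackMap φ ≫ h, ψ.y, ?_⟩
  rw [Category.assoc, h']
  exact CospanElements.pullbackMap_fst ψ

/-- An equation between values of the two coprojections is witnessed by a cospan. -/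
theorem exists_of_inl_eq_inr {a : C} (y : G.obj a) (z : H.obj a)
    (hw : (inl α β).app a y = (inr α β).app a z) :
    ∃ (e : CospanElements α β) (u : e.c ⟶ a) (v : e.k ⟶ a),
      G.map u e.y = y ∧ H.map v e.z = z ∧ pullback.fst e.f e.g ≫ u = pullback.snd e.f e.g ≫ v := by
  obtain ⟨e, φ, ψ, h⟩ := exists_of_mk_eq hw
  refine ⟨e, φ.c, ψ.k, φ.y, ψ.z, ?_⟩
  exact (CospanElements.pullbackMap_fst φ).symm.trans (h.trans (CospanElements.pullbackMap_snd ψ))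

variable {T : C ⥤ Type t} [PreservesFiniteLimits T]

theorem hom_ext {p q : lexPushout α β ⟶ T} (h₁ : inl α β ≫ p = inl α β ≫ q)
    (h₂ : inr α β ≫ p = inr α β ≫ q) : p = q := by
  ext a w
  obtain ⟨e, h, rfl⟩ := exists_mk w
  -- Each element is the image of a universal one over the pullback of its cospan, and `T` preserves
  -- that pullback.
  have key : p.app _ (mk e (𝟙 _)) = q.app _ (mk e (𝟙 _)) := by
    apply ext_of_isPullback_map T (IsPullback.of_hasPullback e.f e.g)
    · rw [← NatTrans.naturality_apply, ← NatTrans.naturality_apply, map_mk, Category.id_comp,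
        ← Category.comp_id (pullback.fst _ _), ← inl_map]
      exact ConcreteCategory.congr_hom (congr_app h₁ e.c) _
    · rw [← NatTrans.naturality_apply, ← NatTrans.naturality_apply, map_mk, Category.id_comp,
        ← Category.comp_id (pullback.snd _ _), ← inr_map]
      exact ConcreteCategory.congr_hom (congr_app h₂ e.k) _
  rw [← Category.id_comp h, ← map_mk]
  exact (NatTrans.naturality_apply p h _).trans
    ((congrArg (T.map h) key).trans (NatTrans.naturality_apply q h _).symm)

/-- A map to `T` amounts to a compatible family of elements `τ e` of `T` at the pullbacks of the
cospans, and preservation of pullbacks by `T` provides them. -/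
theorem exists_desc (p : G ⟶ T) (q : H ⟶ T) (hpq : α ≫ p = β ≫ q) :
    ∃ r : lexPushout α β ⟶ T, inl α β ≫ r = p ∧ inr α β ≫ r = q := by
  choose τ h₁ h₂ using exists_desc_element p q hpq
  have hτ {e e' : CospanElements α β} (φ : e ⟶ e') :
      T.map (CospanElements.pullbackMap φ) (τ e) = τ e' := by
    apply ext_of_isPullback_map T (IsPullback.of_hasPullback e'.f e'.g)
    · rw [← Functor.map_comp_apply, h₁, ← φ.y, NatTrans.naturality_apply, ← h₁,
        ← Functor.map_comp_apply, CospanElements.pullbackMap_fst]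
    · rw [← Functor.map_comp_apply, h₂, ← φ.z, NatTrans.naturality_apply, ← h₂,
        ← Functor.map_comp_apply, CospanElements.pullbackMap_snd]
  let s (a : C) : Cocone (((CospanElements.pullbackFunctor α β).op ⋙ coyoneda).flip.obj a) :=
    { pt := T.obj a
      ι :=
        { app := fun e => ↾ fun h => T.map h (τ e.unop)
          naturality := fun e e' φ => by
            ext h
            have := congrArg (T.map h) (hτ φ.unop)
            exact (Functor.map_comp_apply _ _ _ _).trans this } }
  have hs (a : C) (e : CospanElements α β) (h : pullback e.f e.g ⟶ a) :
      colimit.desc _ (s a) (mk e h) = T.map h (τ e) :=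
    ConcreteCategory.congr_hom (colimit.ι_desc (s a) (.op e)) h
  refine ⟨{ app := fun a => colimit.desc _ (s a), naturality := fun a b m => ?_ }, ?_, ?_⟩
  · ext w
    obtain ⟨e, h, rfl⟩ := exists_mk w
    refine (congrArg _ (map_mk e h m)).trans ((hs b e _).trans ?_)
    rw [Functor.map_comp_apply, ← hs a e h]
    rfl
  · ext a y
    exact (hs a _ _).trans (h₁ _)
  · ext a z
    exact (hs a _ _).trans (h₂ _)

end lexPushout

end

/-! ### Regular epimorphisms in `C` and lifting of elements over monos. -/

theorem exists_desc_of_isRegularEpi {C : Type u} [Category.{v} C] {X Y Z : C} (q : X ⟶ Y)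
    [hq : IsRegularEpi q] (p : X ⟶ Z)
    (h : ∀ (T : C) (a b : T ⟶ X), a ≫ q = b ≫ q → a ≫ p = b ≫ p) :
    ∃ r : Y ⟶ Z, q ≫ r = p := by
  obtain ⟨s⟩ := hq.regularEpi
  exact ⟨s.desc' p (h _ _ _ s.w), (s.desc' p (h _ _ _ s.w)).2⟩

theorem exists_isRegularEpi_mono_factorisation {C : Type u} [Category.{v} C] [Regular C] {X Y : C}
    (f : X ⟶ Y) : ∃ (I : C) (q : X ⟶ I) (i : I ⟶ Y), IsRegularEpi q ∧ Mono i ∧ q ≫ i = f :=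
  ⟨_, (Regular.strongEpiMonoFactorisation f).e, (Regular.strongEpiMonoFactorisation f).m,
    inferInstance, inferInstance, (Regular.strongEpiMonoFactorisation f).fac⟩

section

variable {C : Type t} [SmallCategory C] {F G H : C ⥤ Type t}

/-- The naturality squares of `β` at monomorphisms are weak pullback squares. -/
def IsCartesianOverMonos (β : F ⟶ H) : Prop :=
  ∀ ⦃a b : C⦄ (m : a ⟶ b) [Mono m] (x : F.obj b) (w : H.obj a),
    H.map m w = β.app b x → ∃ x' : F.obj a, F.map m x' = x

variable [Regular C] [PreservesFiniteLimits F] [PreservesFiniteLimits G]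
  [PreservesFiniteLimits H] {α : F ⟶ G} {β : F ⟶ H}

theorem IsCartesianOverMonos.inl (hβ : IsCartesianOverMonos β) :
    IsCartesianOverMonos (lexPushout.inl α β) := by
  intro a b m _ w v hv
  obtain ⟨e, u, h, rfl, hm⟩ := lexPushout.exists_of_map_eq_inl m v w hv
  -- Only the mono part of `e.g` matters for lifting `e.x`. The regular epi part, pulled back,
  -- covers `pullback e.f i`, and the diagonal filler against `m` descends `h` along this cover.
  obtain ⟨I, q, i, _, _, hq⟩ := exists_isRegularEpi_mono_factorisation e.g
  obtain ⟨x', hx'⟩ := hβ i e.x (H.map q e.z) (by rw [← Functor.map_comp_apply, hq, e.map_z])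
  obtain ⟨y', hy', -⟩ := exists_of_isPullback_map G (IsPullback.of_hasPullback e.f i) e.y
    (α.app _ x') (by rw [e.map_y, ← NatTrans.naturality_apply, hx'])
  have hκ : pullback.fst (pullback.snd e.f i) q ≫ pullback.fst e.f i ≫ e.f =
      pullback.snd (pullback.snd e.f i) q ≫ e.g := by
    rw [pullback.condition, pullback.condition_assoc, hq]
  have sq : CommSq (pullback.lift (pullback.fst (pullback.snd e.f i) q ≫ pullback.fst e.f i)
      (pullback.snd (pullback.snd e.f i) q) (by rw [Category.assoc, hκ]) ≫ h)
      (pullback.fst (pullback.snd e.f i) q) m (pullback.fst e.f i ≫ u) :=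
    ⟨by rw [Category.assoc, hm, pullback.lift_fst_assoc, Category.assoc]⟩
  refine ⟨G.map sq.lift y', ?_⟩
  rw [← Functor.map_comp_apply, sq.fac_right, Functor.map_comp_apply, hy']

/-- This says that `β` is the equalizer of its cokernel pair. -/
theorem IsCartesianOverMonos.exists_of_inl_eq_inr (hβ : IsCartesianOverMonos β) {a : C}
    (w : H.obj a) (hw : (lexPushout.inl β β).app a w = (lexPushout.inr β β).app a w) :
    ∃ x : F.obj a, β.app a x = w := by
  obtain ⟨e, u, v, hu, hv, huv⟩ := lexPushout.exists_of_inl_eq_inr w w hw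
  obtain ⟨p, hp, hp'⟩ := exists_of_isPullback_map H (IsPullback.of_hasPullback e.f e.g) e.y e.z
    (by rw [e.map_y, e.map_z])
  obtain ⟨I, q, i, _, _, hq⟩ :=
    exists_isRegularEpi_mono_factorisation (pullback.fst e.f e.g ≫ e.f)
  -- If `s` and `s'` agree in the image, the first leg of `s` and the second leg of `s'` form a new
  -- point of the pullback; `huv` at this mixed point gives the equality.
  obtain ⟨r, hr⟩ := exists_desc_of_isRegularEpi q (pullback.fst e.f e.g ≫ u) fun T s s' hs => by
    have h₁ : s ≫ pullback.fst e.f e.g ≫ e.f = (s' ≫ pullback.snd e.f e.g) ≫ e.g := by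
      rw [Category.assoc, ← pullback.condition, ← hq, reassoc_of% hs]
    have h₂ := congrArg
      (pullback.lift (s ≫ pullback.fst e.f e.g) (s' ≫ pullback.snd e.f e.g)
        (by rw [Category.assoc, h₁]) ≫ ·) huv
    simp only [pullback.lift_fst_assoc, pullback.lift_snd_assoc, Category.assoc] at h₂
    rw [h₂, huv]
  obtain ⟨x', hx'⟩ := hβ i e.x (H.map q p) (by
    rw [← Functor.map_comp_apply, hq, Functor.map_comp_apply, hp, e.map_y])
  have hβx : β.app _ x' = H.map q p := by
    apply map_injective_of_mono H i
    rw [← NatTrans.naturality_apply, hx', ← Functor.map_comp_apply, hq, Functor.map_comp_apply,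
      hp, e.map_y]
  refine ⟨F.map r x', ?_⟩
  rw [NatTrans.naturality_apply, hβx, ← Functor.map_comp_apply, hr, Functor.map_comp_apply, hp, hu]

omit [Regular C] in
theorem IsCartesianOverMonos.injective [HasFiniteLimits C] (hβ : IsCartesianOverMonos β) (a : C) :
    Function.Injective (β.app a) := by
  intro x y hxy
  obtain ⟨z, rfl, rfl⟩ := exists_prod_map F x y
  -- Injectivity is the lifting condition over the diagonal.
  obtain ⟨x', hx'⟩ := hβ (diag a) z (H.map prod.fst (β.app _ z)) (by
    apply ext_prod_map H
    · rw [← Functor.map_comp_apply (f := diag a), prod.lift_fst, Functor.map_id_apply]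
    · rw [← Functor.map_comp_apply (f := diag a), prod.lift_snd, Functor.map_id_apply,
        ← NatTrans.naturality_apply, ← NatTrans.naturality_apply, hxy])
  rw [← hx', ← Functor.map_comp_apply, ← Functor.map_comp_apply, prod.lift_fst, prod.lift_snd]

end

/-! ### Regular monos of lex functors, and regularity of the pro-completion. -/

section LexFunctors

variable {C : Type t} [SmallCategory C]

instance (F : C ⥤ₗ Type t) : PreservesFiniteLimits F.obj := F.property

/-- Limits of functors are pointwise and commute with finite limits. -/
instance (J : Type w₁) [Category.{w₂} J] [HasLimitsOfShape J (Type t)] :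
    (leftExactFunctor C (Type t)).IsClosedUnderLimitsOfShape J where
  limitsOfShape_le := by
    rintro G ⟨h⟩
    refine ⟨fun K _ _ => ?_⟩
    have (j : J) : PreservesFiniteLimits (h.diag.obj j) := h.prop_diag_obj j
    have : PreservesLimitsOfShape K h.diag.flip :=
      preservesLimitsOfShape_of_evaluation _ _ fun j =>
        inferInstanceAs (PreservesLimitsOfShape K (h.diag.obj j))
    exact preservesLimitsOfShape_of_natIso (F := h.diag.flip ⋙ lim)
      ((limitIsoFlipCompLim h.diag).symm ≪≫
        (limit.isLimit h.diag).conePointUniqueUpToIso h.isLimit)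

namespace LexFunctor

section

variable [HasFiniteLimits C] {F G H : C ⥤ₗ Type t} (α : F ⟶ G) (β : F ⟶ H)

/-- The pushout of finite limit preserving functors. -/
noncomputable def pushout : C ⥤ₗ Type t := LeftExactFunctor.of (lexPushout α.hom β.hom)

/-- The first coprojection. -/
noncomputable def inl : G ⟶ pushout α β := ⟨lexPushout.inl α.hom β.hom⟩

/-- The second coprojection. -/
noncomputable def inr : H ⟶ pushout α β := ⟨lexPushout.inr α.hom β.hom⟩

theorem isPushout : IsPushout α β (inl α β) (inr α β) where
  w := ObjectProperty.hom_ext _ lexPushout.condition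
  isColimit' := ⟨by
    have key (s : PushoutCocone α β) := lexPushout.exists_desc s.inl.hom s.inr.hom
      (congrArg InducedCategory.Hom.hom s.condition)
    choose d h₁ h₂ using key
    exact PushoutCocone.IsColimit.mk _ (fun s => ⟨d s⟩)
      (fun s => ObjectProperty.hom_ext _ (h₁ s)) (fun s => ObjectProperty.hom_ext _ (h₂ s))
      fun s m hm₁ hm₂ => ObjectProperty.hom_ext _ (lexPushout.hom_ext
        ((congrArg InducedCategory.Hom.hom hm₁).trans (h₁ s).symm)
        ((congrArg InducedCategory.Hom.hom hm₂).trans (h₂ s).symm))⟩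

end

instance [HasFiniteLimits C] : HasPushouts (C ⥤ₗ Type t) := by
  have {F G H : C ⥤ₗ Type t} {α : F ⟶ G} {β : F ⟶ H} : HasColimit (span α β) :=
    (isPushout α β).hasPushout
  exact hasPushouts_of_hasColimit_span _

/-- The corepresentable functors, as finite limit preserving functors. -/
def corep (X : C) : C ⥤ₗ Type t := LeftExactFunctor.of (coyoneda.obj (.op X))

/-- The morphism out of a corepresentable functor that corresponds to an element. -/
def homOfElement {X : C} {F : C ⥤ₗ Type t} (x : F.obj.obj X) : corep X ⟶ F :=
  ⟨coyonedaEquiv.symm x⟩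

theorem homOfElement_apply {X : C} {F : C ⥤ₗ Type t} (x : F.obj.obj X) {Y : C} (f : X ⟶ Y) :
    (homOfElement x).hom.app Y f = F.obj.map f x :=
  rfl

theorem corep_hom_ext {X : C} {F : C ⥤ₗ Type t} {p q : corep X ⟶ F}
    (h : p.hom.app X (𝟙 X) = q.hom.app X (𝟙 X)) : p = q :=
  ObjectProperty.hom_ext _ (coyonedaEquiv.injective h)

theorem homOfElement_comp {X : C} {F G : C ⥤ₗ Type t} (x : F.obj.obj X) (β : F ⟶ G) :
    homOfElement x ≫ β = homOfElement (β.hom.app X x) := by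
  apply corep_hom_ext
  change β.hom.app X (F.obj.map (𝟙 X) x) = G.obj.map (𝟙 X) _
  rw [Functor.map_id_apply, Functor.map_id_apply]

theorem homOfElement_injective {X : C} {F : C ⥤ₗ Type t} {x y : F.obj.obj X}
    (h : homOfElement x = homOfElement y) : x = y := by
  have := ConcreteCategory.congr_hom (congr_app (congrArg InducedCategory.Hom.hom h) X) (𝟙 X)
  simpa [homOfElement_apply] using this

theorem nonempty_isInitial_corep_terminal [HasTerminal C] :
    Nonempty (IsInitial (corep (⊤_ C))) := by
  have (F : C ⥤ₗ Type t) : Unique (F.obj.obj (⊤_ C)) :=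
    (nonempty_unique_of_isTerminal F.obj terminalIsTerminal).some
  exact ⟨IsInitial.ofUniqueHom (fun F => homOfElement default)
    fun F m => corep_hom_ext (Subsingleton.elim _ _)⟩

instance [HasTerminal C] : HasInitial (C ⥤ₗ Type t) :=
  nonempty_isInitial_corep_terminal.some.hasInitial

theorem isRegularMono_of_isCartesianOverMonos [Regular C] {F G : C ⥤ₗ Type t} {β : F ⟶ G}
    (hβ : IsCartesianOverMonos β.hom) : IsRegularMono β := by
  have key (s : Fork (inl β β) (inr β β)) (a : C) (y : s.pt.obj.obj a) :
      ∃ x, β.hom.app a x = s.ι.hom.app a y :=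
    hβ.exists_of_inl_eq_inr _ (ConcreteCategory.congr_hom
      (congr_app (congrArg InducedCategory.Hom.hom s.condition) a) y)
  choose d hd using key
  refine ⟨⟨⟨_, _, _, (isPushout β β).w, Fork.IsLimit.mk _
    (fun s => ⟨{ app := fun a => ↾ d s a, naturality := fun a b m => ?_ }⟩) (fun s => ?_)
    fun s m hm => ?_⟩⟩⟩
  · ext y
    apply hβ.injective
    refine (hd s b _).trans ((NatTrans.naturality_apply _ _ _).trans ?_)
    rw [← hd s a y, ← NatTrans.naturality_apply]
    rfl
  · ext a y
    exact hd s a y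
  · ext a y
    apply hβ.injective
    exact (ConcreteCategory.congr_hom (congr_app (congrArg InducedCategory.Hom.hom hm) a) y).trans
      (hd s a y).symm

/-- The two maps equalized by `β` agree on `w`, since they agree after the injection induced by `m`;
so `w` factors through `β`. -/
theorem isCartesianOverMonos_of_isRegularMono {F G : C ⥤ₗ Type t} {β : F ⟶ G}
    (h : IsRegularMono β) : IsCartesianOverMonos β.hom := by
  obtain ⟨⟨s⟩⟩ := h
  have := s.mono
  intro a b m _ x w hw
  have hw' : homOfElement w ≫ s.left = homOfElement w ≫ s.right := by
    rw [homOfElement_comp, homOfElement_comp]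
    congr 1
    apply map_injective_of_mono s.Z.obj m
    rw [← NatTrans.naturality_apply, ← NatTrans.naturality_apply, hw]
    exact ConcreteCategory.congr_hom (congr_app (congrArg InducedCategory.Hom.hom s.w) b) x
  obtain ⟨p, hp⟩ := Fork.IsLimit.lift' s.isLimit _ hw'
  replace hp : p ≫ β = homOfElement w := hp
  refine ⟨p.hom.app a (𝟙 a), homOfElement_injective ?_⟩
  rw [← cancel_mono β, homOfElement_comp, homOfElement_comp, ← hw, NatTrans.naturality_apply]
  congr 2
  have := ConcreteCategory.congr_hom (congr_app (congrArg InducedCategory.Hom.hom hp) a) (𝟙 a)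
  exact this.trans (by rw [homOfElement_apply, Functor.map_id_apply])

theorem isRegularMono_iff [Regular C] {F G : C ⥤ₗ Type t} (β : F ⟶ G) :
    IsRegularMono β ↔ IsCartesianOverMonos β.hom :=
  ⟨isCartesianOverMonos_of_isRegularMono, isRegularMono_of_isCartesianOverMonos⟩

theorem isRegularMono_inl [Regular C] {F G H : C ⥤ₗ Type t} (α : F ⟶ G) (β : F ⟶ H)
    (h : IsRegularMono β) : IsRegularMono (inl α β) :=
  (isRegularMono_iff _).2 ((isRegularMono_iff β).1 h).inl

end LexFunctor

theorem regular_proCompletion [Regular C] : Regular (ProCompletion C) where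
  out := by
    have : HasFiniteColimits (C ⥤ₗ Type t) := hasFiniteColimits_of_hasInitial_and_pushouts
    exact HasFiniteLimits.out
  hasCoequalizer_of_isKernelPair _ := inferInstance
  regularEpiIsStableUnderBaseChange := by
    refine ⟨fun {X Y Y' S f g f' g'} sq hg => ?_⟩
    have h := LexFunctor.isRegularMono_inl f.unop g.unop
      ((isRegularMono_unop_iff_isRegularEpi g).2 hg)
    have h' := MorphismProperty.RespectsIso.postcomp (MorphismProperty.regularMono _)
      ((LexFunctor.isPushout f.unop g.unop).isoIsPushout _ _ sq.unop).hom _ h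
    rw [IsPushout.inl_isoIsPushout_hom] at h'
    exact (isRegularMono_unop_iff_isRegularEpi g').1 h'

end LexFunctors

/-! ### Zero morphisms and local right punctuality in `C`. -/

section

variable {C : Type u} [Category.{v} C]

theorem isZeroMorphism_iff [HasZeroObject C] [HasZeroMorphisms C] {X Y : C} (f : X ⟶ Y) :
    IsZeroMorphism f ↔ f = 0 := by
  constructor
  · rintro ⟨Z, hZ, a, b, rfl⟩
    rw [hZ.eq_of_tgt a 0, zero_comp]
  · rintro rfl
    obtain ⟨Z, hZ⟩ := HasZeroObject.zero (C := C)
    exact ⟨Z, hZ, 0, 0, zero_comp⟩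

theorem IsZeroMorphism.op {X Y : C} {f : X ⟶ Y} (h : IsZeroMorphism f) : IsZeroMorphism f.op := by
  obtain ⟨Z, hZ, a, b, rfl⟩ := h
  exact ⟨_, hZ.op, b.op, a.op, rfl⟩

theorem IsZeroMorphism.unop {X Y : Cᵒᵖ} {f : X ⟶ Y} (h : IsZeroMorphism f) :
    IsZeroMorphism f.unop := by
  obtain ⟨Z, hZ, a, b, rfl⟩ := h
  exact ⟨_, hZ.unop, b.unop, a.unop, rfl⟩

/-- In a regular subtractive category, reflexive left punctual spans that need not be jointly
monic, nor reflexive on the nose, are right punctual after passing to a cover. -/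
theorem exists_local_right_punctual [Regular C] [SubtractiveCategory C] [HasZeroMorphisms C]
    {c n d b : C} (f : c ⟶ d) (u : c ⟶ b) (e s : n ⟶ c) (hes : e ≫ f = s ≫ f) (hs : s ≫ u = 0) :
    ∃ (n' : C) (q : n' ⟶ n) (p : n' ⟶ c), IsRegularEpi q ∧ p ≫ f = 0 ∧ p ≫ u = q ≫ e ≫ u := by
  have hw₁ (w : n ⟶ n ⨯ n) (e' : n ⟶ c) (h₁ : e' ≫ f = (w ≫ prod.fst) ≫ e ≫ f)
      (h₂ : e' ≫ u = (w ≫ prod.snd) ≫ e ≫ u) :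
      e' ≫ prod.lift f u = w ≫ prod.map (e ≫ f) (e ≫ u) := by
    apply Limits.prod.hom_ext
    · simpa only [Category.assoc, prod.lift_fst, prod.map_fst] using h₁
    · simpa only [Category.assoc, prod.lift_snd, prod.map_snd] using h₂
  -- `I` is the relation on `n` of pairs `(x, y)` for which, locally, some point of `c` has the
  -- `f`-value of `e x` and the `u`-value of `e y`. The point `e x` makes it reflexive, and `s x`
  -- relates `x` to zero. That zero is related to every `y` is then the claim.
  obtain ⟨I, q, i, _, _, hq⟩ := exists_isRegularEpi_mono_factorisation
    (pullback.snd (prod.lift f u) (prod.map (e ≫ f) (e ≫ u)))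
  have refl : ReflexiveRelation (i ≫ prod.fst) (i ≫ prod.snd) :=
    { right_cancellation := fun T x y hx hy => by
        rw [← cancel_mono i]
        apply Limits.prod.hom_ext <;> simpa
      r := pullback.lift e (diag n) (hw₁ _ _
        (by rw [prod.lift_fst, Category.id_comp]) (by rw [prod.lift_snd, Category.id_comp])) ≫ q
      reflexivity₁ := by
        rw [Category.assoc, reassoc_of% hq, pullback.lift_snd_assoc, prod.lift_fst]
      reflexivity₂ := by
        rw [Category.assoc, reassoc_of% hq, pullback.lift_snd_assoc, prod.lift_snd] }
  obtain ⟨σ, hσ₁, hσ₂⟩ := SubtractiveCategory.isRightPunctual _ _ refl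
    ⟨pullback.lift s (prod.lift (𝟙 n) 0) (hw₁ _ _
      (by rw [prod.lift_fst, Category.id_comp, hes])
      (by rw [prod.lift_snd, zero_comp, hs])) ≫ q,
      by rw [Category.assoc, reassoc_of% hq, pullback.lift_snd_assoc, prod.lift_fst],
      by
        rw [isZeroMorphism_iff, Category.assoc, reassoc_of% hq, pullback.lift_snd_assoc,
          prod.lift_snd]⟩
  rw [isZeroMorphism_iff] at hσ₁
  have hc₁ := (pullback.condition (f := prod.lift f u) (g := prod.map (e ≫ f) (e ≫ u)))
  have hc₂ := pullback.condition (f := σ) (g := q)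
  have k₁ := congrArg (· ≫ prod.fst) hc₁
  have k₂ := congrArg (· ≫ prod.snd) hc₁
  simp only [Category.assoc, prod.lift_fst, prod.lift_snd, prod.map_fst, prod.map_snd] at k₁ k₂
  refine ⟨pullback σ q, pullback.fst σ q, pullback.snd σ q ≫ pullback.fst _ _, inferInstance,
    ?_, ?_⟩
  · rw [Category.assoc, k₁, ← hq, Category.assoc, ← reassoc_of% hc₂, reassoc_of% hσ₁]
    simp
  · rw [Category.assoc, k₂, ← hq, Category.assoc, ← reassoc_of% hc₂, reassoc_of% hσ₂]

end

/-! ### Subtractivity of the pro-completion. -/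

section

variable {C : Type t} [SmallCategory C]

namespace LexFunctor

theorem isZero_corep {O : C} (hO : IsZero O) : IsZero (corep O) := by
  have h (Y : C) : Unique (O ⟶ Y) := (hO.unique_to Y).some
  refine ⟨fun F => ?_, fun F => ?_⟩
  · have : Unique (F.obj.obj O) := (nonempty_unique_of_isTerminal F.obj hO.isTerminal).some
    exact ⟨⟨⟨homOfElement default⟩, fun m => corep_hom_ext (Subsingleton.elim _ _)⟩⟩
  · refine ⟨⟨⟨⟨{ app := fun Y => ↾ fun _ => (default : O ⟶ Y), naturality := fun Y Y' m => ?_ }⟩⟩,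
      fun m => ?_⟩⟩
    · ext y
      exact (h Y').instSubsingleton.elim _ _
    · ext Y y
      exact (h Y).instSubsingleton.elim _ _

instance [HasZeroObject C] : HasZeroObject (C ⥤ₗ Type t) := by
  obtain ⟨O, hO⟩ := HasZeroObject.zero (C := C)
  exact ⟨_, isZero_corep hO⟩

theorem exists_of_isZeroMorphism {O : C} (hO : IsZero O) {X Y : C ⥤ₗ Type t} {ρ : X ⟶ Y}
    (hρ : IsZeroMorphism ρ) {b : C} (z : X.obj.obj b) :
    ∃ (g : O ⟶ b) (y : Y.obj.obj O), Y.obj.map g y = ρ.hom.app b z := by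
  obtain ⟨Z, hZ, p, q, rfl⟩ := hρ
  let i := hZ.iso (isZero_corep hO)
  refine ⟨(p ≫ i.hom).hom.app b z, (i.inv ≫ q).hom.app O (𝟙 O), ?_⟩
  have : p ≫ q = (p ≫ i.hom) ≫ (i.inv ≫ q) := by simp
  rw [this]
  refine (NatTrans.naturality_apply (i.inv ≫ q).hom ((p ≫ i.hom).hom.app b z : O ⟶ b)
    (𝟙 O)).symm.trans ?_
  exact congrArg ((i.inv ≫ q).hom.app b) (Category.id_comp ((p ≫ i.hom).hom.app b z))

variable [Regular C] [SubtractiveCategory C] {X R Z : C ⥤ₗ Type t}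

theorem isCartesianOverMonos_comp_inl {ρ₁ ρ₂ : X ⟶ R} {ε σ : R ⟶ X} (h₁ : ρ₁ ≫ ε = 𝟙 X)
    (h₂ : ρ₂ ≫ ε = 𝟙 X) (h₃ : ρ₁ ≫ σ = 𝟙 X) (h₄ : IsZeroMorphism (ρ₂ ≫ σ)) (ζ : X ⟶ Z) :
    IsCartesianOverMonos (ρ₂ ≫ inl ρ₁ ζ).hom := by
  intro a b m _ z v hv
  obtain ⟨O, hO⟩ := HasZeroObject.zero (C := C)
  let _ : HasZeroMorphisms C := hO.hasZeroMorphisms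
  obtain ⟨E, u, h, hu, hm⟩ := lexPushout.exists_of_map_eq_inl m v (ρ₂.hom.app b z) hv
  have app_eq {p : X ⟶ R} {q : R ⟶ X} (hpq : p ≫ q = 𝟙 X) (c : C) (x : X.obj.obj c) :
      q.hom.app c (p.hom.app c x) = x :=
    ConcreteCategory.congr_hom (congr_app (congrArg InducedCategory.Hom.hom hpq) c) x
  -- Both `ε` and `σ` retract `ρ₁`, so the two images of `E.y` agree over `E.d` and define an
  -- element of the kernel pair of `E.f`.
  obtain ⟨x₁, hε, hσ⟩ := exists_of_isPullback_map X.obj (IsPullback.of_hasPullback E.f E.f)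
    (ε.hom.app _ E.y) (σ.hom.app _ E.y) (by
      rw [← NatTrans.naturality_apply, ← NatTrans.naturality_apply, E.map_y, app_eq h₁,
        app_eq h₃])
  obtain ⟨g, o, ho⟩ := exists_of_isZeroMorphism hO h₄ z
  -- As `ρ₂ ≫ σ` is zero, the element restricts to the part of the kernel pair whose second
  -- component vanishes under `u`.
  obtain ⟨x₂, hx₂, -⟩ := exists_of_isPullback_map X.obj
    (IsPullback.of_hasPullback (pullback.snd E.f E.f ≫ u) g) x₁ o (by
      rw [ho, Functor.map_comp_apply, hσ, ← NatTrans.naturality_apply, hu]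
      rfl)
  obtain ⟨n', q, p, _, hpf, hpu⟩ := exists_local_right_punctual E.f u
    (pullback.fst (pullback.snd E.f E.f ≫ u) g ≫ pullback.fst E.f E.f)
    (pullback.fst (pullback.snd E.f E.f ≫ u) g ≫ pullback.snd E.f E.f)
    (by rw [Category.assoc, Category.assoc, pullback.condition])
    (by rw [Category.assoc, pullback.condition, hO.eq_of_src g 0, comp_zero])
  -- Since `p` is killed by `E.f`, it pairs with zero to a point of the pullback, where `h` applies.
  -- The filler is defined on all of `n`, so the element need not be lifted along the cover `q`.
  have sq : CommSq (pullback.lift p 0 (by rw [hpf, zero_comp]) ≫ h) q m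
      ((pullback.fst (pullback.snd E.f E.f ≫ u) g ≫ pullback.fst E.f E.f) ≫ u) :=
    ⟨by rw [Category.assoc, hm, pullback.lift_fst_assoc, hpu]⟩
  refine ⟨X.obj.map sq.lift x₂, ?_⟩
  rw [← Functor.map_comp_apply, sq.fac_right, Functor.map_comp_apply, Functor.map_comp_apply, hx₂,
    hε, ← NatTrans.naturality_apply, hu, app_eq h₂]

theorem exists_right_copunctual {ρ₁ ρ₂ : X ⟶ R} {ε σ : R ⟶ X} (h₁ : ρ₁ ≫ ε = 𝟙 X)
    (h₂ : ρ₂ ≫ ε = 𝟙 X) (h₃ : ρ₁ ≫ σ = 𝟙 X) (h₄ : IsZeroMorphism (ρ₂ ≫ σ))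
    (hρ : ∀ (T : C ⥤ₗ Type t) (p q : R ⟶ T), ρ₁ ≫ p = ρ₁ ≫ q → ρ₂ ≫ p = ρ₂ ≫ q → p = q) :
    ∃ τ : R ⟶ X, IsZeroMorphism (ρ₁ ≫ τ) ∧ ρ₂ ≫ τ = 𝟙 X := by
  obtain ⟨Z, hZ⟩ := HasZeroObject.zero (C := C ⥤ₗ Type t)
  let ζ : X ⟶ Z := hZ.from_ X
  have hmono : IsRegularMono (ρ₂ ≫ inl ρ₁ ζ) :=
    (isRegularMono_iff _).2 (isCartesianOverMonos_comp_inl h₁ h₂ h₃ h₄ ζ)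
  have sq := isPushout ρ₁ ζ
  -- Any two maps out of the pushout agree on `ρ₁ ≫ inl ρ₁ ζ`, which factors through zero; agreement
  -- on the `ρ₂` side then suffices by `hρ`.
  have hepi : Epi (ρ₂ ≫ inl ρ₁ ζ) := ⟨fun p q hpq => sq.hom_ext
    (hρ _ _ _ (by rw [sq.w_assoc, sq.w_assoc, hZ.eq_of_src (inr ρ₁ ζ ≫ p)]) (by simpa using hpq))
    (hZ.eq_of_src _ _)⟩
  have : IsIso (ρ₂ ≫ inl ρ₁ ζ) := isIso_of_regularMono_of_epi _ hmono.regularMono.some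
  refine ⟨inl ρ₁ ζ ≫ inv (ρ₂ ≫ inl ρ₁ ζ), ⟨Z, hZ, ζ, inr ρ₁ ζ ≫ inv (ρ₂ ≫ inl ρ₁ ζ), ?_⟩, ?_⟩
  · rw [← sq.w_assoc]
  · rw [← Category.assoc, IsIso.hom_inv_id]

end LexFunctor

theorem subtractiveCategory_proCompletion [Regular C] [SubtractiveCategory C] :
    SubtractiveCategory (ProCompletion C) where
  toHasFiniteLimits := (regular_proCompletion (C := C)).toHasFiniteLimits
  toHasZeroObject := inferInstance
  isRightPunctual := by
    intro R X r₁ r₂ hr ⟨s, hs₁, hs₂⟩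
    obtain ⟨τ, hτ₁, hτ₂⟩ := LexFunctor.exists_right_copunctual (ρ₁ := r₁.unop) (ρ₂ := r₂.unop)
      (ε := hr.r.unop) (σ := s.unop) (congrArg Quiver.Hom.unop hr.reflexivity₁)
      (congrArg Quiver.Hom.unop hr.reflexivity₂) (congrArg Quiver.Hom.unop hs₁) hs₂.unop
      (fun T p q hp hq => Quiver.Hom.op_inj (hr.right_cancellation _ _
        (congrArg Quiver.Hom.op hp) (congrArg Quiver.Hom.op hq)))
    exact ⟨τ.op, hτ₁.op, congrArg Quiver.Hom.op hτ₂⟩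

end

/-! ### Invariance of regularity and subtractivity under equivalence. -/

section Equivalence

variable {C : Type u} [Category.{v} C] {D : Type w₁} [Category.{w₂} D]

theorem isRegularEpi_map (F : C ⥤ D) [PreservesColimitsOfShape WalkingParallelPair F] {X Y : C}
    (f : X ⟶ Y) (h : IsRegularEpi f) : IsRegularEpi (F.map f) := by
  obtain ⟨⟨s⟩⟩ := h
  exact ⟨⟨⟨_, F.map s.left, F.map s.right, by rw [← F.map_comp, s.w, F.map_comp],
    isColimitCoforkMapOfIsColimit F s.w s.isColimit⟩⟩⟩

theorem isRegularEpi_of_map (F : C ⥤ D) [F.IsEquivalence] {X Y : C} (f : X ⟶ Y)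
    (h : IsRegularEpi (F.map f)) : IsRegularEpi f := by
  have h' := isRegularEpi_map F.inv _ h
  exact ((MorphismProperty.regularEpi C).arrow_mk_iso_iff
    ((Arrow.isoOfNatIso F.asEquivalence.unitIso (Arrow.mk f)))).2 h'

theorem hasFiniteLimits_of_isEquivalence (F : D ⥤ C) [F.IsEquivalence] [HasFiniteLimits C] :
    HasFiniteLimits D :=
  ⟨fun _ _ _ => Adjunction.hasLimitsOfShape_of_equivalence F⟩

/-- Regularity is invariant under equivalence. -/
theorem regular_of_isEquivalence (F : D ⥤ C) [F.IsEquivalence] [Regular C] : Regular D where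
  toHasFiniteLimits := hasFiniteLimits_of_isEquivalence F
  hasCoequalizer_of_isKernelPair {X Y Z f g₁ g₂} h := by
    have : HasCoequalizer (F.map g₁) (F.map g₂) :=
      Regular.hasCoequalizer_of_isKernelPair (h.map F)
    have : HasColimit (parallelPair g₁ g₂ ⋙ F) :=
      hasColimit_of_iso (F := parallelPair (F.map g₁) (F.map g₂))
        (diagramIsoParallelPair (parallelPair g₁ g₂ ⋙ F))
    exact Adjunction.hasColimit_of_comp_equivalence _ F
  regularEpiIsStableUnderBaseChange :=
    ⟨fun {X Y Y' S f g f' g'} sq hg => isRegularEpi_of_map F _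
      (Regular.regularEpiIsStableUnderBaseChange.of_isPullback (sq.map F)
        (isRegularEpi_map F g hg))⟩

theorem isZero_obj (F : C ⥤ D) [F.IsEquivalence] {Z : C} (hZ : IsZero Z) : IsZero (F.obj Z) :=
  IsZero.of_full_of_faithful_of_isZero F.inv _ (hZ.of_iso (F.asEquivalence.unitIso.app Z).symm)

theorem IsZeroMorphism.map (F : C ⥤ D) [F.IsEquivalence] {X Y : C} {f : X ⟶ Y}
    (h : IsZeroMorphism f) : IsZeroMorphism (F.map f) := by
  obtain ⟨Z, hZ, a, b, rfl⟩ := h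
  exact ⟨_, isZero_obj F hZ, F.map a, F.map b, (F.map_comp a b).symm⟩

theorem IsZeroMorphism.of_map (F : C ⥤ D) [F.IsEquivalence] {X Y : C} {f : X ⟶ Y}
    (h : IsZeroMorphism (F.map f)) : IsZeroMorphism f := by
  obtain ⟨Z, hZ, a, b, hab⟩ := h
  let i := F.objObjPreimageIso Z
  refine ⟨_, IsZero.of_full_of_faithful_of_isZero F _ (hZ.of_iso i), F.preimage (a ≫ i.inv),
    F.preimage (i.hom ≫ b), F.map_injective ?_⟩
  simp [hab]

/-- Subtractivity is invariant under equivalence. -/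
theorem subtractiveCategory_of_isEquivalence (F : D ⥤ C) [F.IsEquivalence]
    [SubtractiveCategory C] : SubtractiveCategory D where
  toHasFiniteLimits := hasFiniteLimits_of_isEquivalence F
  toHasZeroObject := by
    obtain ⟨Z, hZ⟩ := HasZeroObject.zero (C := C)
    exact ⟨_, isZero_obj F.inv hZ⟩
  isRightPunctual {R X} r₁ r₂ hr := by
    rintro ⟨s, hs₁, hs₂⟩
    have : JointlyMono₂ (F.map r₁) (F.map r₂) := ⟨fun Y f g hf hg => by
      let i := F.objObjPreimageIso Y
      rw [← cancel_epi i.hom]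
      obtain ⟨f', hf'⟩ := F.map_surjective (i.hom ≫ f)
      obtain ⟨g', hg'⟩ := F.map_surjective (i.hom ≫ g)
      rw [← hf', ← hg']
      congr 1
      apply hr.right_cancellation
      · exact F.map_injective (by simp [hf', hg', hf])
      · exact F.map_injective (by simp [hf', hg', hg])⟩
    obtain ⟨p, hp₁, hp₂⟩ := SubtractiveCategory.isRightPunctual _ _ (hr.map F)
      ⟨F.map s, by rw [← F.map_comp, hs₁, F.map_id], by rw [← F.map_comp]; exact hs₂.map F⟩
    obtain ⟨q, rfl⟩ := F.map_surjective p
    rw [← F.map_comp] at hp₁ hp₂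
    exact ⟨q, hp₁.of_map F, F.map_injective (by rw [hp₂, F.map_id])⟩

end Equivalence

/-! ### The embedding into the pro-completion. -/

section

variable (C : Type t) [SmallCategory C]

/-- The embedding of a category into its pro-completion. -/
def proEmbedding : C ⥤ ProCompletion C where
  obj X := .op (LexFunctor.corep X)
  map f := Quiver.Hom.op ⟨coyoneda.map f.op⟩
  map_id _ := by
    apply Quiver.Hom.unop_inj
    exact ObjectProperty.hom_ext _ (coyoneda.map_id _)
  map_comp f g := by
    apply Quiver.Hom.unop_inj
    exact ObjectProperty.hom_ext _ (coyoneda.map_comp g.op f.op)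

instance : (proEmbedding C).Full where
  map_surjective {_ Y} f := ⟨f.unop.hom.app Y (𝟙 Y), Quiver.Hom.unop_inj
    (LexFunctor.corep_hom_ext (Category.comp_id _))⟩

instance : (proEmbedding C).Faithful where
  map_injective {X Y f g} h := by
    have := ConcreteCategory.congr_hom (congr_app (congrArg InducedCategory.Hom.hom
      (congrArg Quiver.Hom.unop h)) Y) (𝟙 Y)
    exact (Category.comp_id f).symm.trans (this.trans (Category.comp_id g))

/-- Morphisms from a pro-object to an object of the category are elements. -/
def proEmbeddingCompCoyoneda (S : C ⥤ₗ Type t) :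
    proEmbedding C ⋙ coyoneda.obj (.op (.op S)) ≅ S.obj :=
  NatIso.ofComponents (fun X => Equiv.toIso
    { toFun := fun f => f.unop.hom.app X (𝟙 X)
      invFun := fun x => Quiver.Hom.op (LexFunctor.homOfElement x)
      left_inv := fun f => Quiver.Hom.unop_inj
        (LexFunctor.corep_hom_ext (Functor.map_id_apply S.obj X _))
      right_inv := fun x => Functor.map_id_apply S.obj X x })
    (fun {X Y} f => by
      ext g
      exact (congrArg (g.unop.hom.app Y)
        ((Category.comp_id f).trans (Category.id_comp f).symm)).trans
        (NatTrans.naturality_apply g.unop.hom f (𝟙 X)))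

/-- Maps from a pro-object `S` into the image of `C` form the functor `S`, which is itself left
exact. -/
instance : PreservesFiniteLimits (proEmbedding C) where
  preservesFiniteLimits J _ _ :=
    { preservesLimit := fun {K} => ⟨fun {c} hc => ⟨coyonedaJointlyReflectsLimits _ _ fun X => by
        have := preservesLimitsOfShape_of_natIso (J := J)
          (proEmbeddingCompCoyoneda C X.unop.unop).symm
        exact isLimitOfPreserves (proEmbedding C ⋙ coyoneda.obj X) hc⟩⟩ }

/-- Given a cocone with vertex a pro-object `S`, each element of `S` at `Y` yields a cocone in `C`
with vertex `Y`; descending these one by one gives the induced map. -/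
instance : PreservesColimitsOfSize.{w₁, w₂} (proEmbedding C) where
  preservesColimitsOfShape {J} _ :=
    { preservesColimit := fun {K} => ⟨fun {c} hc => by
        let σ (s : Cocone (K ⋙ proEmbedding C)) (Y : C) (w : s.pt.unop.obj.obj Y) : Cocone K :=
          { pt := Y
            ι :=
              { app := fun j => (s.ι.app j).unop.hom.app Y w
                naturality := fun i j f => (ConcreteCategory.congr_hom (congr_app
                  (congrArg InducedCategory.Hom.hom (congrArg Quiver.Hom.unop (s.w f))) Y)
                  w).trans (Category.comp_id _).symm } }
        refine ⟨⟨fun s => Quiver.Hom.op ⟨{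
          app := fun Y => ↾ fun w => hc.desc (σ s Y w)
          naturality := fun Y Y' m => ?_ }⟩, fun s j => ?_, fun s m hm => ?_⟩⟩
        · ext w
          refine hc.hom_ext fun j => (hc.fac _ _).trans ?_
          refine (NatTrans.naturality_apply (s.ι.app j).unop.hom m w).trans ?_
          refine Eq.trans ?_ (Category.assoc _ _ _)
          exact congrArg (· ≫ m) (hc.fac (σ s Y w) j).symm
        · apply Quiver.Hom.unop_inj
          ext Y w
          exact hc.fac (σ s Y w) j
        · apply Quiver.Hom.unop_inj
          ext Y w
          refine hc.hom_ext fun j => Eq.trans ?_ (hc.fac (σ s Y w) j).symm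
          exact ConcreteCategory.congr_hom (congr_app (congrArg InducedCategory.Hom.hom
            (congrArg Quiver.Hom.unop (hm j))) Y) w⟩ }

end

theorem exists_regular_subtractive_embedding (C : Type u) [Category.{v} C] [Regular C]
    [SubtractiveCategory C] :
    ∃ (D : Type (max u v + 1)) (_ : Category.{max u v} D) (F : C ⥤ D),
      Regular D ∧ SubtractiveCategory D ∧ HasBinaryCoproducts D ∧
      F.Full ∧ F.Faithful ∧ Function.Injective F.obj ∧
      PreservesFiniteLimits F ∧ PreservesColimitsOfSize.{w₁, w₂} F := by
  let E := AsSmall.{max u v} C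
  have : (AsSmall.up : C ⥤ E).IsEquivalence := AsSmall.equiv.isEquivalence_functor
  have : (AsSmall.down : E ⥤ C).IsEquivalence := AsSmall.equiv.isEquivalence_inverse
  have hE : Regular E := regular_of_isEquivalence (AsSmall.down : E ⥤ C)
  have hE' : SubtractiveCategory E :=
    subtractiveCategory_of_isEquivalence (AsSmall.down : E ⥤ C)
  have hP : Regular (ProCompletion E) := regular_proCompletion
  have hP' : SubtractiveCategory (ProCompletion E) := subtractiveCategory_proCompletion
  -- Labelling each pro-object by an object of `C` keeps the category the same up to equivalence and
  -- makes the embedding injective on objects, with no need to recover `X` from its corepresentable.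
  let p : ProCompletion E × C → ProCompletion E := Prod.fst
  let y : C ⥤ ProCompletion E := AsSmall.up ⋙ proEmbedding E
  let F : C ⥤ InducedCategory (ProCompletion E) p :=
    { obj := fun X => (y.obj X, X)
      map := fun f => InducedCategory.homMk (y.map f)
      map_id := fun X => InducedCategory.hom_ext (y.map_id X)
      map_comp := fun f g => InducedCategory.hom_ext (y.map_comp f g) }
  have : (inducedFunctor p).EssSurj :=
    ⟨fun X => ⟨(X, HasZeroObject.zero.choose), ⟨Iso.refl _⟩⟩⟩
  have : (inducedFunctor p).IsEquivalence := {}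
  have hy : F ⋙ inducedFunctor p = y := rfl
  refine ⟨_, inferInstance, F, regular_of_isEquivalence (inducedFunctor p),
    subtractiveCategory_of_isEquivalence (inducedFunctor p),
    Adjunction.hasColimitsOfShape_of_equivalence (inducedFunctor p), ?_, ?_,
    fun X Y h => congrArg Prod.snd h, ?_, ?_⟩
  · have : (F ⋙ inducedFunctor p).Full := by
      rw [hy]
      dsimp only [y]
      infer_instance
    exact Functor.Full.of_comp_faithful F (inducedFunctor p)
  · have : (F ⋙ inducedFunctor p).Faithful := by
      rw [hy]
      dsimp only [y]
      infer_instance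
    exact Functor.Faithful.of_comp F (inducedFunctor p)
  · have : PreservesFiniteLimits (F ⋙ inducedFunctor p) := by
      rw [hy]
      dsimp only [y]
      infer_instance
    exact ⟨fun J _ _ => preservesLimitsOfShape_of_reflects_of_preserves F (inducedFunctor p)⟩
  · have : PreservesColimitsOfSize.{w₁, w₂} (F ⋙ inducedFunctor p) := by
      rw [hy]
      dsimp only [y]
      infer_instance
    exact preservesColimits_of_reflects_of_preserves F (inducedFunctor p)

theorem mainTheorem6 :
    (∀ (C : Type t) [SmallCategory C] [Regular C] [SubtractiveCategory C],
      Regular (ProCompletion C) ∧ SubtractiveCategory (ProCompletion C)) ∧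
    (∀ (C : Type u) [Category.{v} C] [Regular C] [SubtractiveCategory C],
      ∃ (D : Type (max u v + 1)) (_ : Category.{max u v} D) (F : C ⥤ D),
        Regular D ∧ SubtractiveCategory D ∧ HasBinaryCoproducts D ∧
        F.Full ∧ F.Faithful ∧ Function.Injective F.obj ∧
        PreservesFiniteLimits F ∧ PreservesColimitsOfSize.{w₁, w₂} F) :=
  ⟨fun _ _ _ _ => ⟨regular_proCompletion, subtractiveCategory_proCompletion⟩,
    fun C _ _ _ => exists_regular_subtractive_embedding C⟩
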